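/- Let $k$ be an algebraically closed field (of any characteristic). A variety is a reduced, separated scheme of finite type over $k$ (not necessarily irreducible), and a point of a variety is a $k$-rational (equivalently, closed) point. An algebraic semigroup is a variety $S$ equipped with a morphism of $k$-varieties $\mu : S \times S \to S$, $(x,y) \mapsto xy$, that is associative on points. A homomorphism of algebraic semigroups is a morphism of $k$-varieties $f : S \to S'$ such that $f(xy) = f(x)f(y)$ for all points $x, y$ of $S$. Let $E(S)$ denote the set of idempotents of $S$, i.e. of points $e$ of $S$ with $ee = e$. Then: 1. Every nonempty algebraic semigroup $S$ over $k$ has an idempotent, i.e. $E(S) \neq \emptyset$. 2. If $f : S \to S'$ is a homomorphism of algebraic semigroups over $k$ that is surjective on points, then $f(E(S)) = E(S')$. -/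

import Mathlib

open CategoryTheory AlgebraicGeometry

universe u

namespace AlgSemigroup

open MonoidalCategory CartesianMonoidalCategory

/-- A variety over an algebraically closed field `k`: a `k`-scheme that is reduced, separated and
of finite type (not necessarily irreducible, connected or nonempty). -/
class IsVariety {k : Type u} [Field k] [IsAlgClosed k]
    (X : Over (Spec (CommRingCat.of k))) : Prop where
  reduced : IsReduced X.left
  separated : IsSeparated X.hom
  locallyOfFiniteType : LocallyOfFiniteType X.hom
  quasiCompact : QuasiCompact X.hom

/-- The points of a `k`-scheme: its `k`-rational points, i.e. the morphisms `Spec k ⟶ X` over `k`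
(the monoidal unit of `Over (Spec k)` is `Spec k` itself). For `X` locally of finite type over an
algebraically closed field, these correspond to the closed points of `X`. -/
abbrev Point {k : Type u} [Field k] (X : Over (Spec (CommRingCat.of k))) : Type u :=
  𝟙_ (Over (Spec (CommRingCat.of k))) ⟶ X

/-- An algebraic semigroup over the algebraically closed field `k`: a variety `X` with a morphism
`μ : X × X ⟶ X` of varieties (the product is the fibre product over `Spec k`), such that the
composition law induced on the set of points is associative. -/
structure AlgebraicSemigroup (k : Type u) [Field k] [IsAlgClosed k] where
  /-- the underlying `k`-scheme -/
  X : Over (Spec (CommRingCat.of k))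
  isVariety : IsVariety X
  /-- the composition law -/
  μ : X ⊗ X ⟶ X
  assoc : ∀ x y z : Point X,
    lift (lift x y ≫ μ) z ≫ μ = lift x (lift y z ≫ μ) ≫ μ

/-- The semigroup of points of an algebraic semigroup, with product `x * y = μ (x, y)`. -/
noncomputable instance AlgebraicSemigroup.semigroupPoint {k : Type u} [Field k] [IsAlgClosed k]
    (S : AlgebraicSemigroup k) : Semigroup (Point S.X) where
  mul x y := lift x y ≫ S.μ
  mul_assoc := S.assoc

/-- The set `E(S)` of idempotents of an algebraic semigroup: the points `e` with `e * e = e`. -/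
def AlgebraicSemigroup.E {k : Type u} [Field k] [IsAlgClosed k]
    (S : AlgebraicSemigroup k) : Set (Point S.X) :=
  {e | IsIdempotentElem e}

/-- The map on points induced by a morphism of `k`-schemes. -/
noncomputable def onPoints {k : Type u} [Field k] {X Y : Over (Spec (CommRingCat.of k))} (f : X ⟶ Y) :
    Point X → Point Y :=
  fun x => x ≫ f

/-- A homomorphism of algebraic semigroups: a morphism of varieties that is a homomorphism of
semigroups on points. -/
structure AlgebraicSemigroup.Hom {k : Type u} [Field k] [IsAlgClosed k]
    (S S' : AlgebraicSemigroup k) where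
  /-- the underlying morphism of varieties -/
  f : S.X ⟶ S'.X
  map_mul : ∀ x y : Point S.X, onPoints f (x * y) = onPoints f x * onPoints f y

end AlgSemigroup

/-! ### Constructible sets and dense open subsets of their closures. -/

open Topology TopologicalSpace

/-! In a minimal closed subsemigroup `M`, every nonempty subsemigroup is dense, by minimality; in
particular the tails of the powers of `x` and each `c * M` are dense. Hence `D = {(a, a * b)}` is
dense in `M × M`. By Chevalley's theorem `D` is constructible, so it contains a nonempty relatively
open part of its closure, and that part contains some `(x ^ p, x ^ q)` with `p > q`. Thus `x ^ q = x
^ p * s = x ^ q * t` with `t ∈ M`. The elements of `M` fixing `x ^ q` on the right form a closed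
subsemigroup, hence all of `M`, so `x ^ q` is idempotent. For a surjective homomorphism, apply this
to the fibre over an idempotent. -/

/-- A set `D` contains a dense open subset of its closure (in the strong form that every open set
meeting `D` contains an open set `W` meeting `D` with `W ∩ closure D ⊆ D`). -/
def HasDenseOpenInClosure {α : Type*} [TopologicalSpace α] (D : Set α) : Prop :=
  ∀ V : Set α, IsOpen V → (V ∩ D).Nonempty →
    ∃ W ⊆ V, IsOpen W ∧ (W ∩ D).Nonempty ∧ W ∩ closure D ⊆ D

theorem IsLocallyClosed.hasDenseOpenInClosure {α : Type*} [TopologicalSpace α] {D : Set α}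
    (hD : IsLocallyClosed D) : HasDenseOpenInClosure D := by
  obtain ⟨U, F, hU, hF, rfl⟩ := hD
  rintro V hV ⟨x, hxV, hxU, hxF⟩
  refine ⟨V ∩ U, Set.inter_subset_left, hV.inter hU, ⟨x, ⟨hxV, hxU⟩, hxU, hxF⟩, ?_⟩
  rintro y ⟨⟨-, hyU⟩, hy⟩
  exact ⟨hyU, closure_minimal Set.inter_subset_right hF hy⟩

/-- Either an open set good for one piece can be shrunk off the closure of the other, or it meets
the other piece and can be shrunk to be good for both. -/
theorem HasDenseOpenInClosure.union {α : Type*} [TopologicalSpace α] {D₁ D₂ : Set α}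
    (h₁ : HasDenseOpenInClosure D₁) (h₂ : HasDenseOpenInClosure D₂) :
    HasDenseOpenInClosure (D₁ ∪ D₂) := by
  have key : ∀ {D₁ D₂ : Set α}, HasDenseOpenInClosure D₁ → HasDenseOpenInClosure D₂ →
      ∀ V : Set α, IsOpen V → (V ∩ D₁).Nonempty →
      ∃ W ⊆ V, IsOpen W ∧ (W ∩ (D₁ ∪ D₂)).Nonempty ∧ W ∩ closure (D₁ ∪ D₂) ⊆ D₁ ∪ D₂ := by
    intro D₁ D₂ h₁ h₂ V hV hne
    obtain ⟨W, hWV, hW, ⟨x, hxW, hx⟩, hsub⟩ := h₁ V hV hne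
    by_cases hx₂ : x ∈ closure D₂
    · obtain ⟨y, hyW, hy⟩ := mem_closure_iff.1 hx₂ W hW hxW
      obtain ⟨W', hW'W, hW', ⟨z, hzW', hz⟩, hsub'⟩ := h₂ W hW ⟨y, hyW, hy⟩
      refine ⟨W', hW'W.trans hWV, hW', ⟨z, hzW', Or.inr hz⟩, ?_⟩
      rw [closure_union]
      rintro t ⟨ht, ht' | ht'⟩
      · exact Or.inl (hsub ⟨hW'W ht, ht'⟩)
      · exact Or.inr (hsub' ⟨ht, ht'⟩)
    · refine ⟨W ∩ (closure D₂)ᶜ, Set.inter_subset_left.trans hWV,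
        hW.inter isClosed_closure.isOpen_compl, ⟨x, ⟨hxW, hx₂⟩, Or.inl hx⟩, ?_⟩
      rw [closure_union]
      rintro t ⟨⟨ht, hnt⟩, ht' | ht'⟩
      · exact Or.inl (hsub ⟨ht, ht'⟩)
      · exact absurd ht' hnt
  rintro V hV ⟨x, hxV, hx | hx⟩
  · exact key h₁ h₂ V hV ⟨x, hxV, hx⟩
  · rw [Set.union_comm]
    exact key h₂ h₁ V hV ⟨x, hxV, hx⟩

/-- The preimage of a constructible subset of a Noetherian space under a continuous map contains a
dense open subset of its closure. -/
theorem Topology.IsConstructible.hasDenseOpenInClosure_preimage {α β : Type*} [TopologicalSpace α]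
    [TopologicalSpace β] [NoetherianSpace β] {f : α → β} (hf : Continuous f) {s : Set β}
    (hs : IsConstructible s) : HasDenseOpenInClosure (f ⁻¹' s) := by
  induction s, hs using IsConstructible.induction_of_isTopologicalBasis
      (fun U : Opens β => (U : Set β)) with
  | basis =>
    refine isTopologicalBasis_of_isOpen_of_nhds ?_ fun a v ha hv => ⟨v, ⟨⟨v, hv⟩, rfl⟩, ha, le_rfl⟩
    rintro _ ⟨U, rfl⟩
    exact U.isOpen
  | isCompact_basis U => exact NoetherianSpace.isCompact _
  | sdiff U s hs =>
    refine IsLocallyClosed.hasDenseOpenInClosure (IsLocallyClosed.preimage ?_ hf)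
    exact U.isOpen.isLocallyClosed.inter
      (isOpen_biUnion fun V _ => V.isOpen).isClosed_compl.isLocallyClosed
  | union s _ t _ h₁ h₂ => exact h₁.union h₂

/-! ### Idempotents in semigroups with continuous translations. -/

/-- The powers `x ^ (n + 1)` in a semigroup. -/
def succPow {P : Type*} [Semigroup P] (x : P) : ℕ → P
  | 0 => x
  | n + 1 => succPow x n * x

theorem succPow_mul_succPow {P : Type*} [Semigroup P] (x : P) (m n : ℕ) :
    succPow x m * succPow x n = succPow x (m + n + 1) := by
  induction n with
  | zero => rfl
  | succ n ih => rw [succPow, ← mul_assoc, ih]; rfl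

section Semigroup

variable {P : Type*} [Semigroup P] [TopologicalSpace P]

/-- A nonempty closed subset stable under multiplication. -/
structure IsClosedSubsemigroup (C : Set P) : Prop where
  isClosed : IsClosed C
  nonempty : C.Nonempty
  mul_mem : ∀ a ∈ C, ∀ b ∈ C, a * b ∈ C

/-- One factor is passed to the closure at a time, as only separate continuity is available. -/
theorem isClosedSubsemigroup_closure {A : Set P}
    (hl : ∀ a : P, Continuous (a * ·)) (hr : ∀ a : P, Continuous (· * a))
    (hA : A.Nonempty) (hmul : ∀ a ∈ A, ∀ b ∈ A, a * b ∈ A) :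
    IsClosedSubsemigroup (closure A) := by
  have h₁ : ∀ a ∈ A, ∀ b ∈ closure A, a * b ∈ closure A := fun a ha b hb =>
    map_mem_closure (hl a) hb fun c hc => hmul a ha c hc
  refine ⟨isClosed_closure, hA.closure, fun a ha b hb => ?_⟩
  have h₂ := map_mem_closure (hr b) ha fun c hc => h₁ c hc b hb
  rwa [closure_closure] at h₂

theorem IsClosedSubsemigroup.exists_minimal [NoetherianSpace P] {C : Set P}
    (hC : IsClosedSubsemigroup C) :
    ∃ M ⊆ C, IsClosedSubsemigroup M ∧ ∀ N ⊆ M, IsClosedSubsemigroup N → N = M := by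
  obtain ⟨M, ⟨hMC, hM⟩, hmin⟩ := wellFounded_lt.has_min
    {M : Closeds P | (M : Set P) ⊆ C ∧ IsClosedSubsemigroup (M : Set P)}
    ⟨⟨C, hC.isClosed⟩, le_rfl, hC⟩
  refine ⟨M, hMC, hM, fun N hNM hN => ?_⟩
  by_contra hne
  exact hmin ⟨N, hN.isClosed⟩ ⟨hNM.trans hMC, hN⟩
    (lt_of_le_of_ne hNM fun h => hne (congrArg (fun K : Closeds P => (K : Set P)) h))

theorem IsClosedSubsemigroup.succPow_mem {C : Set P} (hC : IsClosedSubsemigroup C) {x : P}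
    (hx : x ∈ C) (n : ℕ) : succPow x n ∈ C := by
  induction n with
  | zero => exact hx
  | succ n ih => exact hC.mul_mem _ ih _ hx

/-- A closed subsemigroup `C` of a semigroup on a Noetherian `T₁` space with continuous translations
contains an idempotent, provided the sets `{(a, a * b) | a, b ∈ M}` contain a dense open subset of
their closure, for a topology on pairs which makes the slices continuous. -/
theorem IsClosedSubsemigroup.exists_isIdempotentElem [NoetherianSpace P] [T1Space P]
    (hl : ∀ a : P, Continuous (a * ·)) (hr : ∀ a : P, Continuous (· * a))
    {Q : Type*} [TopologicalSpace Q] (pair : P → P → Q)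
    (hpair : ∀ {a b a' b'}, pair a b = pair a' b' → a = a' ∧ b = b')
    (hpl : ∀ a, Continuous (pair a)) (hpr : ∀ b, Continuous (pair · b))
    (hD : ∀ M : Set P, IsClosed M →
      HasDenseOpenInClosure {q | ∃ a ∈ M, ∃ b ∈ M, q = pair a (a * b)})
    {C : Set P} (hC : IsClosedSubsemigroup C) : ∃ e ∈ C, IsIdempotentElem e := by
  obtain ⟨M, hMC, hM, hmin⟩ := hC.exists_minimal
  have hdense : ∀ A ⊆ M, A.Nonempty → (∀ a ∈ A, ∀ b ∈ A, a * b ∈ A) → closure A = M :=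
    fun A hAM hA hmul => hmin _ (closure_minimal hAM hM.isClosed) (isClosedSubsemigroup_closure hl hr hA hmul)
  obtain ⟨x, hx⟩ := hM.nonempty
  have hpow : ∀ m, closure {y | ∃ n, m ≤ n ∧ y = succPow x n} = M := by
    intro m
    refine hdense _ ?_ ⟨_, m, le_rfl, rfl⟩ ?_
    · rintro _ ⟨n, -, rfl⟩
      exact hM.succPow_mem hx n
    · rintro _ ⟨n, hn, rfl⟩ _ ⟨n', -, rfl⟩
      exact ⟨n + n' + 1, by omega, succPow_mul_succPow x n n'⟩
  obtain ⟨W, -, hW, ⟨_, hqW, a, ha, b, hb, rfl⟩, hsub⟩ := hD M hM.isClosed Set.univ isOpen_univ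
    ⟨_, trivial, x, hx, x, hx, rfl⟩
  have hprod : ∀ c ∈ M, ∀ d ∈ M,
      pair c d ∈ closure {q | ∃ a ∈ M, ∃ b ∈ M, q = pair a (a * b)} := by
    intro c hc d hd
    have hcM : closure ((c * ·) '' M) = M := by
      refine hdense _ ?_ (hM.nonempty.image _) ?_
      · rintro _ ⟨y, hy, rfl⟩
        exact hM.mul_mem _ hc _ hy
      · rintro _ ⟨y, hy, rfl⟩ _ ⟨z, hz, rfl⟩
        exact ⟨y * (c * z), hM.mul_mem _ hy _ (hM.mul_mem _ hc _ hz), by simp [mul_assoc]⟩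
    rw [← hcM] at hd
    refine map_mem_closure (hpl c) hd ?_
    rintro _ ⟨y, hy, rfl⟩
    exact ⟨c, hc, y, hy, rfl⟩
  -- choose `j` and then `i > j` with `(x ^ (i + 1), x ^ (j + 1)) ∈ W`
  have hab : a * b ∈ closure {y | ∃ n, 0 ≤ n ∧ y = succPow x n} := by
    rw [hpow]; exact hM.mul_mem _ ha _ hb
  obtain ⟨_, hjW, j, -, rfl⟩ := mem_closure_iff.1 hab _ (hW.preimage (hpl a)) hqW
  -- Starting the tail at `j + 1` forces `i > j`, so that `succPow x j` can be split off `succPow x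
  -- i`.
  have ha' : a ∈ closure {y | ∃ n, j + 1 ≤ n ∧ y = succPow x n} := by rwa [hpow]
  obtain ⟨_, hiW, i, hji, rfl⟩ := mem_closure_iff.1 ha' _ (hW.preimage (hpr (succPow x j))) hjW
  have hiM := hM.succPow_mem hx i
  have hjM := hM.succPow_mem hx j
  obtain ⟨c, -, s, hs, hcs⟩ := hsub ⟨hiW, hprod _ hiM _ hjM⟩
  obtain ⟨rfl, hjs⟩ := hpair hcs
  obtain ⟨d, rfl⟩ : ∃ d, i = j + d + 1 := ⟨i - j - 1, by omega⟩
  rw [← succPow_mul_succPow, mul_assoc] at hjs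
  -- the right stabilizer of `x ^ (j + 1)` is a closed subsemigroup, hence everything
  have hstab : {y | y ∈ M ∧ succPow x j * y = succPow x j} = M := by
    refine hmin _ (fun y hy => hy.1) ⟨?_, ?_, ?_⟩
    · exact hM.isClosed.inter (isClosed_singleton.preimage (hl (succPow x j)))
    · exact ⟨_, hM.mul_mem _ (hM.succPow_mem hx d) _ hs, hjs.symm⟩
    · rintro y ⟨hy, hy'⟩ z ⟨hz, hz'⟩
      exact ⟨hM.mul_mem _ hy _ hz, by rw [← mul_assoc, hy', hz']⟩
  rw [← hstab] at hjM
  exact ⟨_, hMC hjM.1, hjM.2⟩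

end Semigroup

/-! ### Zariski topology on rational points. -/

namespace AlgSemigroup

open MonoidalCategory CartesianMonoidalCategory

section Points

variable {k : Type u} [Field k]

/-- The image of a point in the underlying topological space. -/
noncomputable def Point.toSpace {X : Over (Spec (CommRingCat.of k))} (x : Point X) : X.left :=
  x.left (IsLocalRing.closedPoint k : PrimeSpectrum k)

/-- The Zariski topology on the set of points. -/
noncomputable instance (X : Over (Spec (CommRingCat.of k))) : TopologicalSpace (Point X) :=
  .induced Point.toSpace inferInstance

theorem Point.isInducing_toSpace (X : Over (Spec (CommRingCat.of k))) :
    IsInducing (Point.toSpace : Point X → X.left) := ⟨rfl⟩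

theorem toSpace_onPoints {X Y : Over (Spec (CommRingCat.of k))} (f : X ⟶ Y) (x : Point X) :
    (onPoints f x).toSpace = f.left x.toSpace := by
  simp only [onPoints, Point.toSpace, Over.comp_left]
  exact Scheme.Hom.comp_apply _ _ _

theorem continuous_onPoints {X Y : Over (Spec (CommRingCat.of k))} (f : X ⟶ Y) :
    Continuous (onPoints f) := by
  rw [(Point.isInducing_toSpace Y).continuous_iff]
  simpa only [Function.comp_def, toSpace_onPoints] using
    f.left.continuous.comp (Point.isInducing_toSpace X).continuous

/-- The slice is induced by a morphism `Y ⟶ X ⊗ Y`. -/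
theorem continuous_lift_left {X Y : Over (Spec (CommRingCat.of k))} (x : Point X) :
    Continuous (fun y : Point Y => (lift x y : Point (X ⊗ Y))) := by
  convert! continuous_onPoints (lift (toUnit Y ≫ x) (𝟙 Y)) using 2 with y
  simp [onPoints, ← Category.assoc, Subsingleton.elim (y ≫ toUnit Y) (𝟙 _)]

theorem continuous_lift_right {X Y : Over (Spec (CommRingCat.of k))} (y : Point Y) :
    Continuous (fun x : Point X => (lift x y : Point (X ⊗ Y))) := by
  convert! continuous_onPoints (lift (𝟙 X) (toUnit X ≫ y)) using 2 with x
  simp [onPoints, ← Category.assoc, Subsingleton.elim (x ≫ toUnit X) (𝟙 _)]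

theorem isNoetherian_left (X : Over (Spec (CommRingCat.of k)))
    [LocallyOfFiniteType X.hom] [QuasiCompact X.hom] : IsNoetherian X.left := by
  have := LocallyOfFiniteType.isLocallyNoetherian (Y := Spec (CommRingCat.of k)) X.hom
  have : CompactSpace X.left :=
    (quasiCompact_iff_compactSpace (Y := Spec (CommRingCat.of k)) X.hom).mp ‹_›
  constructor

variable [IsAlgClosed k] (X : Over (Spec (CommRingCat.of k))) [LocallyOfFiniteType X.hom]

theorem Point.isClosed_toSpace {X : Over (Spec (CommRingCat.of k))} [LocallyOfFiniteType X.hom]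
    (x : Point X) : IsClosed {x.toSpace} :=
  (pointEquivClosedPoint X.hom ⟨x.left, by simp⟩).2

theorem Point.toSpace_injective : Function.Injective (Point.toSpace : Point X → X.left) := by
  intro x y h
  ext1
  exact ext_of_apply_closedPoint_eq X.hom (by simp) (by simp) h

variable {X} in
theorem exists_toSpace_eq {p : X.left} (hp : IsClosed {p}) : ∃ x : Point X, x.toSpace = p :=
  ⟨Over.homMk (pointOfClosedPoint X.hom p hp) (by simp), pointOfClosedPoint_apply X.hom p hp _⟩

instance : T1Space (Point X) :=
  ⟨fun x => by
    convert! x.isClosed_toSpace.preimage (Point.isInducing_toSpace X).continuous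
    ext y
    simp [(Point.toSpace_injective X).eq_iff]⟩

variable {X} in
theorem exists_toSpace_mem {Z : Set X.left} (hZ : IsClosed Z) (hne : Z.Nonempty) :
    ∃ x : Point X, x.toSpace ∈ Z := by
  have : JacobsonSpace X.left :=
    LocallyOfFiniteType.jacobsonSpace (Y := Spec (CommRingCat.of k)) X.hom
  obtain ⟨p, hp, hp'⟩ := nonempty_inter_closedPoints hne hZ.isLocallyClosed
  obtain ⟨x, rfl⟩ := exists_toSpace_eq hp'
  exact ⟨x, hp⟩

instance [QuasiCompact X.hom] : NoetherianSpace (Point X) :=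
  have := isNoetherian_left X
  (Point.isInducing_toSpace X).noetherianSpace

variable {X} in
/-- The image on points of a closed set under a morphism of schemes of finite type over an
algebraically closed field contains a dense open subset of its closure. -/
theorem hasDenseOpenInClosure_image_onPoints {Y : Over (Spec (CommRingCat.of k))}
    [LocallyOfFiniteType Y.hom] [QuasiCompact X.hom] [QuasiCompact Y.hom] (f : X ⟶ Y)
    {Z : Set (Point X)} (hZ : IsClosed Z) : HasDenseOpenInClosure (onPoints f '' Z) := by
  obtain ⟨F, hF, rfl⟩ := (Point.isInducing_toSpace X).isClosed_iff.1 hZ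
  have := isNoetherian_left X
  have := isNoetherian_left Y
  have : LocallyOfFiniteType (f.left ≫ Y.hom) := by rwa [Over.w]
  have : LocallyOfFiniteType f.left := locallyOfFiniteType_of_comp f.left Y.hom
  have hcons : IsConstructible (f.left '' F) := by
    refine f.left.isConstructible_image ?_
    rw [← isConstructible_compl]
    exact (NoetherianSpace.isCompact _).isConstructible hF.isOpen_compl
  convert! hcons.hasDenseOpenInClosure_preimage (Point.isInducing_toSpace Y).continuous
  ext y
  constructor
  · rintro ⟨x, hx, rfl⟩
    exact ⟨_, hx, (toSpace_onPoints f x).symm⟩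
  · rintro ⟨p, hp, hpy⟩
    -- The fibre of `F` over the closed point `y` is closed and nonempty, so it has a rational
    -- point.
    obtain ⟨x, hxF, hxy⟩ := exists_toSpace_mem
      (hF.inter (y.isClosed_toSpace.preimage f.left.continuous)) ⟨p, hp, hpy⟩
    exact ⟨x, hxF, Point.toSpace_injective Y ((toSpace_onPoints f x).trans hxy)⟩

end Points

/-! ### Application to algebraic semigroups. -/

section

variable {k : Type u} [Field k] [IsAlgClosed k]

instance (S : AlgebraicSemigroup k) : LocallyOfFiniteType S.X.hom := S.isVariety.locallyOfFiniteType

instance (S : AlgebraicSemigroup k) : QuasiCompact S.X.hom := S.isVariety.quasiCompact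

theorem AlgebraicSemigroup.mul_def (S : AlgebraicSemigroup k) (x y : Point S.X) :
    x * y = lift x y ≫ S.μ := rfl

theorem AlgebraicSemigroup.exists_mem_E (S : AlgebraicSemigroup k) {C : Set (Point S.X)}
    (hC : IsClosedSubsemigroup C) : ∃ e ∈ C, e ∈ S.E := by
  have : LocallyOfFiniteType (S.X ⊗ S.X).hom := by dsimp; infer_instance
  have : QuasiCompact (S.X ⊗ S.X).hom := by dsimp; infer_instance
  refine hC.exists_isIdempotentElem (Q := Point (S.X ⊗ S.X))
    (fun a => (continuous_onPoints S.μ).comp (continuous_lift_left a))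
    (fun a => (continuous_onPoints S.μ).comp (continuous_lift_right a))
    (fun a b => lift a b) (fun {a b a' b'} h => ?_) continuous_lift_left continuous_lift_right
    fun M hM => ?_
  · exact ⟨by simpa using congrArg (· ≫ fst S.X S.X) h, by simpa using congrArg (· ≫ snd S.X S.X) h⟩
  · convert! hasDenseOpenInClosure_image_onPoints (lift (fst S.X S.X) S.μ)
      ((hM.preimage (continuous_onPoints (fst S.X S.X))).inter
        (hM.preimage (continuous_onPoints (snd S.X S.X))))
    ext q
    constructor
    · rintro ⟨a, ha, b, hb, rfl⟩
      refine ⟨lift a b, ⟨by simpa [onPoints] using ha, by simpa [onPoints] using hb⟩, ?_⟩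
      simp [onPoints, AlgebraicSemigroup.mul_def]
    · rintro ⟨r, ⟨ha, hb⟩, rfl⟩
      refine ⟨_, ha, _, hb, ?_⟩
      have hr : lift (r ≫ fst S.X S.X) (r ≫ snd S.X S.X) = r := by
        rw [← comp_lift, lift_fst_snd, Category.comp_id]
      simp only [onPoints, AlgebraicSemigroup.mul_def, hr, comp_lift]

end

end AlgSemigroup

theorem proposition2p3 (k : Type u) [Field k] [IsAlgClosed k] :
    (∀ S : AlgSemigroup.AlgebraicSemigroup k, Nonempty S.X.left →
      S.E.Nonempty) ∧
    (∀ (S S' : AlgSemigroup.AlgebraicSemigroup k) (φ : S.Hom S'),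
      Function.Surjective (AlgSemigroup.onPoints φ.f) →
        AlgSemigroup.onPoints φ.f '' S.E = S'.E) := by
  refine ⟨fun S ⟨p⟩ => ?_, fun S S' φ hφ => Set.Subset.antisymm ?_ fun e he => ?_⟩
  · obtain ⟨x, -⟩ := AlgSemigroup.exists_toSpace_mem (isClosed_univ (X := S.X.left)) ⟨p, trivial⟩
    obtain ⟨e, -, he⟩ := S.exists_mem_E
      ⟨isClosed_univ, ⟨x, trivial⟩, fun _ _ _ _ => trivial⟩
    exact ⟨e, he⟩
  · rintro _ ⟨e, he, rfl⟩
    exact (φ.map_mul e e).symm.trans (congrArg _ he)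
  · obtain ⟨x, hx⟩ := hφ e
    obtain ⟨e', he', hE⟩ := S.exists_mem_E (C := AlgSemigroup.onPoints φ.f ⁻¹' {e})
      ⟨isClosed_singleton.preimage (AlgSemigroup.continuous_onPoints φ.f), ⟨x, hx⟩,
        fun a ha b hb => by
          rw [Set.mem_preimage, Set.mem_singleton_iff] at ha hb ⊢
          rw [φ.map_mul, ha, hb]
          exact he⟩
    exact ⟨e', hE, he'⟩
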